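/- Let $I$ be a finite set and let $\Delta$ be a building over $I$ of right-angled type $M=(m_{ij})_{i,j\in I}$, i.e. $m_{ij}\in\{2,\infty\}$ for all $i\neq j$, viewed as a chamber system. Suppose that $\Delta$ is semiregular with (possibly infinite) parameters $(q_i)_{i\in I}$: every $i$-panel has exactly $q_i\ge 2$ chambers. Let $X_i$ be sets with $|X_i|=q_i$ and let $\lambda=(\lambda_i)_{i\in I}\colon\Delta\to\prod_{i\in I}X_i$ be a legal colouring, i.e. on every $i$-panel $\mathcal P$ the restriction $\lambda_i|_{\mathcal P}\colon\mathcal P\to X_i$ is a bijection and $\lambda_j|_{\mathcal P}$ is constant for each $j\ne i$. For every $i\in I$ let $F_i\le\operatorname{Sym}(X_i)$ be an arbitrary permutation group, and let $$U=U_\Delta^\lambda(\boldsymbol F)=\{g\in\operatorname{Aut}(\Delta) : \lambda_i|_{g\mathcal P}\circ g|_{\mathcal P}\circ(\lambda_i|_{\mathcal P})^{-1}\in F_i\text{ for every }i\in I\text{ and every }i\text{-panel }\mathcal P\},$$ where $\operatorname{Aut}(\Delta)$ is the group of type-preserving automorphisms. Let $U^+$ be the subgroup of $U$ generated by all stabilisers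 in $U$ of chambers of $\Delta$. Then the following are equivalent: (i) $U^+=U$; (ii) for every $i\in I$ the group $F_i$ is generated by its point stabilisers $(F_i)_x$, $x\in X_i$, and there is a subset $V\subseteq I$ such that for all $i,j\in I$ with $m_{ij}=\infty$ one has $i\in V$ or $j\in V$ (that is, $V$ is a vertex cover of the diagram), and $F_i$ is transitive on $X_i$ for every $i\in V$. -/

import Mathlib

/-- A chamber system over `I` with chamber set `C`: for each `i : I` an equivalence relation on `C`,
called `i`-adjacency. Its classes are the `i`-panels. -/
structure ChamberSystem (I : Type*) (C : Type*) where
  adj : I → Setoid C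

namespace ChamberSystem

/-- The `i`-panel containing the chamber `c`. -/
def panel {I C : Type*} (D : ChamberSystem I C) (i : I) (c : C) : Set C :=
  {d | (D.adj i).r c d}

/-- `D.Gallery w x y`: there is a gallery of type `w` from `x` to `y`, that is, a sequence of
chambers in which each chamber is adjacent to, and distinct from, the next one. -/
def Gallery {I C : Type*} (D : ChamberSystem I C) : List I → C → C → Prop
  | [], x, y => x = y
  | i :: w, x, y => ∃ z, (D.adj i).r x z ∧ x ≠ z ∧ D.Gallery w z y

/-- A building of type `M`: a non-empty chamber system in which every panel has at least two
chambers, with a Weyl-group-valued distance `δ` such that, for every reduced word `w`, one has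
`δ x y = r_w` if and only if `x` and `y` are joined by a gallery of type `w`.
(In a `CoxeterMatrix`, the entry `0` stands for `∞`.) -/
structure IsBuilding {I C : Type*} (D : ChamberSystem I C) (M : CoxeterMatrix I) : Prop where
  nonempty : Nonempty C
  panel_nontrivial : ∀ (i : I) (c : C), (D.panel i c).Nontrivial
  exists_dist : ∃ δ : C → C → M.Group, ∀ w : List I, M.toCoxeterSystem.IsReduced w →
    ∀ x y : C, δ x y = M.toCoxeterSystem.wordProd w ↔ D.Gallery w x y

/-- The group of (type-preserving) automorphisms. -/
def Aut {I C : Type*} (D : ChamberSystem I C) : Subgroup (Equiv.Perm C) where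
  carrier := {g | ∀ i x y, (D.adj i).r (g x) (g y) ↔ (D.adj i).r x y}
  one_mem' := fun _ _ _ => Iff.rfl
  mul_mem' := fun {g h} hg hh i x y => (hg i (h x) (h y)).trans (hh i x y)
  inv_mem' := fun {g} hg i x y => by
    have h := hg i (g⁻¹ x) (g⁻¹ y)
    simpa using h.symm

/-- The bijection from the panel `P` of `c` to the panel `g P` of `g c` induced by `g`. -/
def panelEquiv {I C : Type*} (D : ChamberSystem I C) (g : D.Aut) (i : I) (c : C) :
    D.panel i c ≃ D.panel i (g.1 c) :=
  g.1.subtypeEquiv fun d => (g.2 i c d).symm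

/-- A legal colouring with colour sets `X i`: on every `i`-panel, the `i`-colour is a bijection
onto `X i` and, for `j ≠ i`, the `j`-colour is constant. In particular all `i`-panels have the
same cardinality, that of `X i`. -/
structure LegalColouring {I C : Type*} (D : ChamberSystem I C) (X : I → Type*) where
  col : C → ∀ i, X i
  bijective : ∀ (i : I) (c : C), Function.Bijective fun d : D.panel i c => col d.1 i
  constant : ∀ (i j : I), j ≠ i → ∀ c : C, ∀ d ∈ D.panel i c, col d j = col c j

namespace LegalColouring

/-- The `i`-colour, as a bijection from the `i`-panel of `c` to `X i`. -/
noncomputable def panelColour {I C : Type*} {D : ChamberSystem I C} {X : I → Type*}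
    (L : D.LegalColouring X) (i : I) (c : C) : D.panel i c ≃ X i :=
  Equiv.ofBijective _ (L.bijective i c)

/-- The local action `λ_i|_{gP} ∘ g|_P ∘ (λ_i|_P)⁻¹` of `g` at the `i`-panel `P` containing `c`. -/
noncomputable def localAction {I C : Type*} {D : ChamberSystem I C} {X : I → Type*}
    (L : D.LegalColouring X) (g : D.Aut) (i : I) (c : C) : Equiv.Perm (X i) :=
  (L.panelColour i c).symm.trans ((D.panelEquiv g i c).trans (L.panelColour i (g.1 c)))

theorem localAction_col {I C : Type*} {D : ChamberSystem I C} {X : I → Type*}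
    (L : D.LegalColouring X) (g : D.Aut) (i : I) (c : C) (d : C) (hd : d ∈ D.panel i c) :
    L.localAction g i c (L.col d i) = L.col (g.1 d) i := by
  have h : (L.panelColour i c).symm (L.col d i) = ⟨d, hd⟩ := by
    rw [Equiv.symm_apply_eq]; rfl
  simp only [localAction, Equiv.trans_apply, h]
  rfl

theorem exists_col_eq {I C : Type*} {D : ChamberSystem I C} {X : I → Type*}
    (L : D.LegalColouring X) (i : I) (c : C) (x : X i) : ∃ d ∈ D.panel i c, L.col d i = x := by
  obtain ⟨⟨d, hd⟩, h⟩ := (L.bijective i c).2 x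
  exact ⟨d, hd, h⟩

theorem localAction_one {I C : Type*} {D : ChamberSystem I C} {X : I → Type*}
    (L : D.LegalColouring X) (i : I) (c : C) : L.localAction 1 i c = 1 := by
  ext x
  obtain ⟨d, hd, rfl⟩ := L.exists_col_eq i c x
  rw [L.localAction_col 1 i c d hd]
  rfl

theorem localAction_mul {I C : Type*} {D : ChamberSystem I C} {X : I → Type*}
    (L : D.LegalColouring X) (g h : D.Aut) (i : I) (c : C) :
    L.localAction (g * h) i c = L.localAction g i (h.1 c) * L.localAction h i c := by
  ext x
  obtain ⟨d, hd, rfl⟩ := L.exists_col_eq i c x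
  rw [L.localAction_col _ i c d hd, Equiv.Perm.mul_apply, L.localAction_col h i c d hd,
    L.localAction_col g i _ _ ((h.2 i c d).2 hd)]
  rfl

theorem localAction_inv {I C : Type*} {D : ChamberSystem I C} {X : I → Type*}
    (L : D.LegalColouring X) (g : D.Aut) (i : I) (c : C) :
    L.localAction g⁻¹ i c = (L.localAction g i ((g⁻¹).1 c))⁻¹ := by
  have h := L.localAction_mul g g⁻¹ i c
  rw [mul_inv_cancel, L.localAction_one] at h
  exact eq_inv_of_mul_eq_one_right h.symm

/-- The universal group with local groups `F i`: all automorphisms whose local action at every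
`i`-panel lies in `F i`. -/
noncomputable def universalGroup {I C : Type*} {D : ChamberSystem I C} {X : I → Type*}
    (L : D.LegalColouring X) (F : ∀ i, Subgroup (Equiv.Perm (X i))) : Subgroup D.Aut where
  carrier := {g | ∀ i c, L.localAction g i c ∈ F i}
  one_mem' := fun i c => by rw [L.localAction_one]; exact (F i).one_mem
  mul_mem' := fun {g h} hg hh i c => by
    rw [L.localAction_mul]; exact (F i).mul_mem (hg i _) (hh i c)
  inv_mem' := fun {g} hg i c => by
    rw [L.localAction_inv]; exact (F i).inv_mem (hg i _)

end LegalColouring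

end ChamberSystem

/-- `M` is right-angled: `m_{ij} ∈ {2, ∞}` for distinct `i, j`, with `∞` encoded as `0`. -/
def CoxeterMatrix.IsRightAngled {I : Type*} (M : CoxeterMatrix I) : Prop :=
  ∀ i j : I, i ≠ j → M i j = 2 ∨ M i j = 0

/-- The diagram of a right-angled `M`: the vertices `i`, `j` are joined when `m_{ij} = ∞`,
with `∞` encoded as `0`. -/
def CoxeterMatrix.diagram {I : Type*} (M : CoxeterMatrix I) : SimpleGraph I where
  Adj := fun i j => M i j = 0
  symm := ⟨fun i j h => (M.symmetric j i).trans h⟩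
  loopless := ⟨fun i h => by simp at h⟩

/-- For a subgroup `H` of a group acting on `Y`, the subgroup `H⁺` generated by all the
stabilisers in `H` of points of `Y`. -/
def plusSubgroup {G : Type*} [Group G] (Y : Type*) [MulAction G Y] (H : Subgroup G) :
    Subgroup G :=
  ⨆ y : Y, H ⊓ MulAction.stabilizer G y

/-!
Moving the chamber `c` inside its `i`-panel to the chamber of colour `x` gives commuting operations
for commuting types, and the chambers of a right-angled building are the free system of such moves:
since the descents of an element of a right-angled Coxeter group commute pairwise, two minimal
galleries with the same ends differ by commuting squares of moves. Freeness gives automorphisms with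
prescribed constant local actions, and potentials, i.e. functions on chambers with values in a group
in which an `i`-move from `x` to `y` contributes the factor `(φ i x)⁻¹ * φ i y`.

If `U⁺ = U`, an automorphism in `U` with constant local action `f` shows that `f` lies in the group
generated by the point stabilisers of `F i`. If `m_{ij} = ∞` while neither `F i` nor `F j` is
transitive, the colours leaving and entering orbits define a `U⁺`-invariant potential with values in
the Coxeter group, which takes distinct values at `c` and at its image under a commutator of an
`i`-move and a `j`-move; yet these two chambers have the same colours, so `U` maps one to the other.

Conversely, modulo `U⁺` all moves of distinct types commute: either their types commute, or one of
them stays in its `U⁺`-orbit by transitivity. Hence two chambers whose colours are related by the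
groups `F i` lie in the same `U⁺`-orbit.
-/

namespace RightAngledCoxeter

section NumbersGame

variable {B : Type*} (M : CoxeterMatrix B)

/-- The entries `2`, `-2`, `0` of the symmetric Cartan matrix of a right-angled `M`, for `m_{ij}`
equal to `1` (that is, `i = j`), `∞` and `2` respectively. -/
def cartanEntry (i j : B) : ℤ :=
  if M i j = 1 then 2 else if M i j = 0 then -2 else 0

/-- The move at the node `i` in Mozes' numbers game: it changes the sign of the number at `i` and
adds `2` times that number at every node joined to `i`. This is the action of the simple reflection
`i` on the dual of the geometric representation. -/
def fire (i : B) (f : B → ℤ) : B → ℤ :=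
  fun j => f j - cartanEntry M i j * f i

variable {M}

theorem fire_self (i : B) (f : B → ℤ) : fire M i f i = -f i := by
  simp only [fire, cartanEntry, M.diagonal, if_true]
  ring

theorem fire_of_eq_zero {i j : B} (h : M i j = 0) (f : B → ℤ) :
    fire M i f j = f j + 2 * f i := by
  simp only [fire, cartanEntry, h, zero_ne_one, if_false, if_true]
  ring

theorem fire_of_eq_two {i j : B} (h : M i j = 2) (f : B → ℤ) : fire M i f j = f j := by
  simp [fire, cartanEntry, h]

theorem fire_involutive (i : B) : Function.Involutive (fire M i) := fun f => by
  ext j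
  rw [fire, fire_self, fire]
  ring

theorem fire_comm {i j : B} (h : M i j = 2) (f : B → ℤ) :
    fire M i (fire M j f) = fire M j (fire M i f) := by
  ext k
  rw [fire, fire_of_eq_two ((M.symmetric j i).trans h), fire, fire,
    fire_of_eq_two h, fire]
  ring

theorem le_fire (hM : M.IsRightAngled) {i j : B} (hij : i ≠ j) {f : B → ℤ} (hf : 0 < f i) :
    f j ≤ fire M i f j := by
  rcases hM i j hij with h | h
  · rw [fire_of_eq_two h]
  · rw [fire_of_eq_zero h]
    omega

theorem isLiftable_fire (hM : M.IsRightAngled) :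
    M.IsLiftable fun i => (fire_involutive (M := M) i).toPerm := by
  intro i j
  have sq : ∀ i, (fire_involutive (M := M) i).toPerm * (fire_involutive i).toPerm = 1 :=
    fun i => Equiv.ext (fire_involutive i)
  rcases eq_or_ne i j with rfl | hij
  · rw [M.diagonal, pow_one, sq]
  rcases hM i j hij with h | h
  · have hc : Commute (fire_involutive (M := M) i).toPerm (fire_involutive j).toPerm :=
      Equiv.ext (fire_comm h)
    rw [h, hc.mul_pow, pow_two, pow_two, sq, sq, one_mul]
  · rw [h, pow_zero]

end NumbersGame

variable {B W : Type*} [Group W] {M : CoxeterMatrix B} (cs : CoxeterSystem M W)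

theorem commute_simple {i j : B} (h : M i j = 2) : Commute (cs.simple i) (cs.simple j) := by
  have hsq := cs.simple_mul_simple_pow i j
  rw [h, pow_two] at hsq
  have hinv := eq_inv_of_mul_eq_one_left hsq
  rwa [mul_inv_rev, cs.inv_simple, cs.inv_simple] at hinv

theorem ascending_induction {p : W → Prop} (one : p 1)
    (simple_mul : ∀ w i, ¬cs.IsLeftDescent w i → p w → p (cs.simple i * w)) (w : W) : p w := by
  induction hn : cs.length w generalizing w with
  | zero => rwa [cs.length_eq_zero_iff.1 hn]
  | succ n ih =>
    obtain ⟨i, hi⟩ := cs.exists_leftDescent_of_ne_one (w := w) fun h => by simp [h] at hn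
    have hlen := cs.isLeftDescent_iff.1 hi
    have hp := simple_mul _ i (cs.isLeftDescent_iff_not_isLeftDescent_mul.1 hi) (ih _ (by omega))
    rwa [cs.simple_mul_simple_cancel_left] at hp

theorem isLeftDescent_simple_mul {w : W} {i : B} (hi : ¬cs.IsLeftDescent w i) :
    cs.IsLeftDescent (cs.simple i * w) i := by
  rwa [cs.isLeftDescent_iff_not_isLeftDescent_mul, cs.simple_mul_simple_cancel_left]

theorem isLeftDescent_simple_mul_of_eq_two {w : W} {i j : B} (hij : M i j = 2)
    (hi : ¬cs.IsLeftDescent w i) (hj : cs.IsLeftDescent w j) :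
    cs.IsLeftDescent (cs.simple i * w) j := by
  have hlen := cs.length_mul_le (cs.simple i) (cs.simple j * w)
  rw [cs.length_simple, ← mul_assoc, (commute_simple cs hij).eq, mul_assoc] at hlen
  rw [cs.isLeftDescent_iff] at hj
  rw [cs.not_isLeftDescent_iff] at hi
  rw [CoxeterSystem.IsLeftDescent]
  omega

section RightAngled

variable (hM : M.IsRightAngled)

/-- The configuration of the numbers game reached from the constant configuration `1` by playing
a word for `w`, last letter first. -/
def weights (w : W) : B → ℤ :=
  cs.lift ⟨fun i => (fire_involutive (M := M) i).toPerm, isLiftable_fire hM⟩ w fun _ => 1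

theorem weights_one : weights cs hM 1 = fun _ => 1 := by
  simp [weights]

theorem weights_simple_mul (i : B) (w : W) :
    weights cs hM (cs.simple i * w) = fire M i (weights cs hM w) := by
  rw [weights, map_mul, cs.lift_apply_simple (isLiftable_fire hM)]
  rfl

/-- The two invariants have to be proved together: the positivity of sums keeps the nodes joined to
a fired node positive. -/
theorem weights_sign_and_add_pos (w : W) :
    (∀ i, 0 < weights cs hM w i ∨ weights cs hM w i < 0 ∧ cs.IsLeftDescent w i) ∧
      ∀ i j, M i j = 0 → 0 < weights cs hM w i + weights cs hM w j := by
  induction w using ascending_induction cs with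
  | one => simp [weights_one]
  | simple_mul w k hk ih =>
    obtain ⟨hsign, hadd⟩ := ih
    rw [weights_simple_mul]
    generalize weights cs hM w = f at hsign hadd
    have hfk : 0 < f k := (hsign k).resolve_right fun h => hk h.2
    refine ⟨fun i => ?_, fun i j hij => ?_⟩
    · rcases eq_or_ne k i with rfl | hki
      · exact Or.inr ⟨by rw [fire_self]; omega, isLeftDescent_simple_mul cs hk⟩
      rcases hM k i hki with h | h
      · rw [fire_of_eq_two h]
        exact (hsign i).imp_right fun hi =>
          ⟨hi.1, isLeftDescent_simple_mul_of_eq_two cs h hk hi.2⟩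
      · rw [fire_of_eq_zero h]
        have := hadd k i h
        omega
    · have := hadd i j hij
      have hji := (M.symmetric j i).trans hij
      rcases eq_or_ne k i with rfl | hki
      · rw [fire_self, fire_of_eq_zero hij]
        omega
      rcases eq_or_ne k j with rfl | hkj
      · rw [fire_self, fire_of_eq_zero hji]
        omega
      have := le_fire hM hki hfk
      have := le_fire hM hkj hfk
      omega

theorem isLeftDescent_iff_weights_neg {w : W} {i : B} :
    cs.IsLeftDescent w i ↔ weights cs hM w i < 0 := by
  refine ⟨fun hi => ?_, fun hneg =>
    ((weights_sign_and_add_pos cs hM w).1 i).elim (fun hpos => by omega) And.right⟩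
  have hi' := cs.isLeftDescent_iff_not_isLeftDescent_mul.1 hi
  have hpos := ((weights_sign_and_add_pos cs hM (cs.simple i * w)).1 i).resolve_right
    fun h => hi' h.2
  rw [weights_simple_mul, fire_self] at hpos
  omega

include hM

theorem isLeftDescent_simple_mul_iff_of_eq_two {w : W} {i j : B} (hij : M i j = 2) :
    cs.IsLeftDescent (cs.simple i * w) j ↔ cs.IsLeftDescent w j := by
  rw [isLeftDescent_iff_weights_neg cs hM, isLeftDescent_iff_weights_neg cs hM,
    weights_simple_mul, fire_of_eq_two hij]

theorem eq_two_of_isLeftDescent {w : W} {i j : B} (hij : i ≠ j) (hi : cs.IsLeftDescent w i)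
    (hj : cs.IsLeftDescent w j) : M i j = 2 := by
  refine (hM i j hij).resolve_right fun h => ?_
  have hadd := (weights_sign_and_add_pos cs hM w).2 i j h
  rw [isLeftDescent_iff_weights_neg cs hM] at hi hj
  omega

theorem not_isLeftDescent_simple {i j : B} (hij : i ≠ j) :
    ¬cs.IsLeftDescent (cs.simple i) j := by
  have hle := le_fire hM hij (f := weights cs hM 1) (by simp [weights_one])
  rw [← weights_simple_mul, mul_one] at hle
  rw [isLeftDescent_iff_weights_neg cs hM, not_lt]
  exact le_trans (by simp [weights_one]) hle

theorem eq_two_of_commute_simple {i j : B} (hij : i ≠ j)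
    (h : Commute (cs.simple i) (cs.simple j)) : M i j = 2 := by
  refine eq_two_of_isLeftDescent cs hM (w := cs.simple i * cs.simple j) hij
    (isLeftDescent_simple_mul cs (not_isLeftDescent_simple cs hM hij.symm)) ?_
  rw [h.eq]
  exact isLeftDescent_simple_mul cs (not_isLeftDescent_simple cs hM hij)

end RightAngled

end RightAngledCoxeter

/-- A coloured system of moves of type `M`: the move `act s i x` changes the `i`-colour of `s` to
`x`, and moves of commuting types commute. The chambers of a right-angled building turn out to be
the free such system on one generator. -/
structure MoveSystem {I : Type*} (M : CoxeterMatrix I) (X : I → Type*) (S : Type*) where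
  col : S → ∀ i, X i
  act : S → ∀ i, X i → S
  col_act_self : ∀ s i x, col (act s i x) i = x
  col_act_of_ne : ∀ s i x j, j ≠ i → col (act s i x) j = col s j
  act_col : ∀ s i, act s i (col s i) = s
  act_act : ∀ s i x y, act (act s i x) i y = act s i y
  act_comm : ∀ i j, M i j = 2 → ∀ s x y, act (act s i x) j y = act (act s j y) i x

namespace MoveSystem

variable {I : Type*} {M : CoxeterMatrix I} {X : I → Type*} {S : Type*}

/-- The system of moves obtained by relabelling the colours: `x` becomes `(f i)⁻¹ x`. -/
def twist (A : MoveSystem M X S) (f : ∀ i, Equiv.Perm (X i)) : MoveSystem M X S where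
  col s i := (f i).symm (A.col s i)
  act s i x := A.act s i (f i x)
  col_act_self s i x := by rw [A.col_act_self, Equiv.symm_apply_apply]
  col_act_of_ne s i x j h := by rw [A.col_act_of_ne _ _ _ _ h]
  act_col s i := by rw [Equiv.apply_symm_apply, A.act_col]
  act_act s i x y := A.act_act _ _ _ _
  act_comm i j h s x y := A.act_comm i j h _ _ _

open Classical in
/-- The system of moves in which an `i`-move from colour `x` to colour `y` multiplies an element of
a group by `(φ i x)⁻¹ * φ i y` on the right. -/
noncomputable def ofGroup {G : Type*} [Group G] (φ : ∀ i, X i → G)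
    (hφ : ∀ i j, M i j = 2 → ∀ x y, Commute (φ i x) (φ j y)) :
    MoveSystem M X (G × ∀ i, X i) where
  col s := s.2
  act s i x := (s.1 * ((φ i (s.2 i))⁻¹ * φ i x), Function.update s.2 i x)
  col_act_self s i x := by simp
  col_act_of_ne s i x j h := by simp [h]
  act_col s i := by simp
  act_act s i x y := by simp [mul_assoc]
  act_comm i j h s x y := by
    have hij : i ≠ j := by
      rintro rfl
      simp at h
    have hcomm : Commute ((φ i (s.2 i))⁻¹ * φ i x) ((φ j (s.2 j))⁻¹ * φ j y) :=
      ((hφ i j h _ _).inv_inv.mul_left (hφ i j h _ _).inv_right).mul_right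
        ((hφ i j h _ _).inv_left.mul_left (hφ i j h _ _))
    simp only [Function.update_of_ne hij, Function.update_of_ne hij.symm]
    exact Prod.ext (by rw [mul_assoc, hcomm.eq, ← mul_assoc]) (Function.update_comm hij _ _ _)

end MoveSystem

namespace ChamberSystem

open RightAngledCoxeter

variable {I C : Type*} {D : ChamberSystem I C} {M : CoxeterMatrix I}

/-- `δ` is a Weyl distance on `D`, as in the definition of a building of type `M`. -/
def IsWeylDistance (D : ChamberSystem I C) (M : CoxeterMatrix I) (δ : C → C → M.Group) : Prop :=
  ∀ w : List I, M.toCoxeterSystem.IsReduced w →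
    ∀ x y : C, δ x y = M.toCoxeterSystem.wordProd w ↔ D.Gallery w x y

namespace IsWeylDistance

variable {δ : C → C → M.Group}

theorem eq_one_iff (hδ : D.IsWeylDistance M δ) {x y : C} : δ x y = 1 ↔ x = y :=
  hδ [] (by simp [CoxeterSystem.IsReduced]) x y

theorem exists_gallery (hδ : D.IsWeylDistance M δ) (x y : C) : ∃ w, D.Gallery w x y := by
  obtain ⟨w, hw, h⟩ := M.toCoxeterSystem.exists_isReduced (δ x y)
  exact ⟨w, (hδ w hw x y).1 h⟩

theorem eq_simple_mul_of_adj (hδ : D.IsWeylDistance M δ) {i : I} {x y z : C}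
    (hi : ¬M.toCoxeterSystem.IsLeftDescent (δ y z) i) (hxy : (D.adj i).r x y) (hne : x ≠ y) :
    δ x z = M.toCoxeterSystem.simple i * δ y z := by
  obtain ⟨w, hw, h⟩ := M.toCoxeterSystem.exists_isReduced (δ y z)
  rw [h, ← CoxeterSystem.wordProd_cons]
  refine (hδ (i :: w) ?_ x z).2 ⟨y, hxy, hne, (hδ w hw y z).1 h⟩
  rw [CoxeterSystem.not_isLeftDescent_iff, h, ← CoxeterSystem.wordProd_cons, hw.eq] at hi
  exact hi

theorem isLeftDescent_of_adj (hδ : D.IsWeylDistance M δ) {i : I} {x y z : C}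
    (hi : ¬M.toCoxeterSystem.IsLeftDescent (δ y z) i) (hxy : (D.adj i).r x y) (hne : x ≠ y) :
    M.toCoxeterSystem.IsLeftDescent (δ x z) i := by
  rw [hδ.eq_simple_mul_of_adj hi hxy hne]
  exact isLeftDescent_simple_mul _ hi

theorem length_lt_of_adj (hδ : D.IsWeylDistance M δ) {i : I} {x y z : C}
    (hi : ¬M.toCoxeterSystem.IsLeftDescent (δ y z) i) (hxy : (D.adj i).r x y) (hne : x ≠ y) :
    M.toCoxeterSystem.length (δ y z) < M.toCoxeterSystem.length (δ x z) := by
  rw [hδ.eq_simple_mul_of_adj hi hxy hne, (CoxeterSystem.not_isLeftDescent_iff _).1 hi]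
  exact Nat.lt_succ_self _

theorem exists_adj_of_isLeftDescent (hδ : D.IsWeylDistance M δ) {i : I} {x z : C}
    (hi : M.toCoxeterSystem.IsLeftDescent (δ x z) i) :
    ∃ y, (D.adj i).r x y ∧ x ≠ y ∧ δ y z = M.toCoxeterSystem.simple i * δ x z := by
  obtain ⟨w, hw, h⟩ := M.toCoxeterSystem.exists_isReduced (M.toCoxeterSystem.simple i * δ x z)
  have hx : δ x z = M.toCoxeterSystem.wordProd (i :: w) := by
    rw [CoxeterSystem.wordProd_cons, ← h, CoxeterSystem.simple_mul_simple_cancel_left]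
  have hred : M.toCoxeterSystem.IsReduced (i :: w) := by
    rw [CoxeterSystem.isLeftDescent_iff, h, hw.eq, hx] at hi
    exact hi.symm
  obtain ⟨y, hxy, hne, hyz⟩ := (hδ _ hred x z).1 hx
  exact ⟨y, hxy, hne, h ▸ (hδ w hw y z).2 hyz⟩

theorem eq_of_adj (hδ : D.IsWeylDistance M δ) {i : I} {x y z : C}
    (hx : ¬M.toCoxeterSystem.IsLeftDescent (δ x z) i)
    (hy : ¬M.toCoxeterSystem.IsLeftDescent (δ y z) i) (hxy : (D.adj i).r x y) : x = y := by
  by_contra hne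
  exact hx (hδ.isLeftDescent_of_adj hy hxy hne)

theorem exists_adj_not_isLeftDescent (hδ : D.IsWeylDistance M δ) (i : I) (x z : C) :
    ∃ y, (D.adj i).r x y ∧ ¬M.toCoxeterSystem.IsLeftDescent (δ y z) i := by
  by_cases hi : M.toCoxeterSystem.IsLeftDescent (δ x z) i
  · obtain ⟨y, hxy, -, hy⟩ := hδ.exists_adj_of_isLeftDescent hi
    refine ⟨y, hxy, ?_⟩
    rwa [hy, ← CoxeterSystem.isLeftDescent_iff_not_isLeftDescent_mul]
  · exact ⟨x, (D.adj i).refl' x, hi⟩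

theorem exists_adj_adj_of_eq_two (hδ : D.IsWeylDistance M δ) (hM : M.IsRightAngled) {i j : I}
    (hij : M i j = 2) {x y z : C} (hxy : (D.adj i).r x y) (hne_xy : x ≠ y)
    (hyz : (D.adj j).r y z) (hne_yz : y ≠ z) :
    ∃ u, (D.adj j).r x u ∧ (D.adj i).r u z := by
  set cs := M.toCoxeterSystem
  have hne : i ≠ j := by
    rintro rfl
    simp at hij
  have hzz : δ z z = 1 := hδ.eq_one_iff.2 rfl
  have hδyz : δ y z = cs.simple j := by
    rw [hδ.eq_simple_mul_of_adj (by simp [hzz, CoxeterSystem.IsLeftDescent]) hyz hne_yz, hzz,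
      mul_one]
  have hδxz : δ x z = cs.simple j * cs.simple i := by
    rw [hδ.eq_simple_mul_of_adj (by rw [hδyz]; exact not_isLeftDescent_simple cs hM hne.symm) hxy
      hne_xy, hδyz, (commute_simple cs hij).eq]
  obtain ⟨u, hxu, -, hδuz⟩ := hδ.exists_adj_of_isLeftDescent (i := j) (x := x) (z := z) <| by
    rw [hδxz]
    exact isLeftDescent_simple_mul cs (not_isLeftDescent_simple cs hM hne)
  rw [hδxz, cs.simple_mul_simple_cancel_left] at hδuz
  obtain ⟨v, huv, -, hδvz⟩ := hδ.exists_adj_of_isLeftDescent (i := i) (x := u) (z := z) <| by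
    rw [hδuz, CoxeterSystem.IsLeftDescent, cs.simple_mul_simple_self, cs.length_one,
      cs.length_simple]
    exact one_pos
  rw [hδuz, cs.simple_mul_simple_self, hδ.eq_one_iff] at hδvz
  exact ⟨u, hxu, hδvz ▸ huv⟩

theorem exists_square_of_isLeftDescent (hδ : D.IsWeylDistance M δ) (hM : M.IsRightAngled)
    {i j : I} (hij : M i j = 2) {b b' c z : C}
    (hbi : ¬M.toCoxeterSystem.IsLeftDescent (δ b z) i) (hbc : (D.adj i).r b c) (hne : b ≠ c)
    (hbj : ¬M.toCoxeterSystem.IsLeftDescent (δ b' z) j) (hbc' : (D.adj j).r b' c) (hne' : b' ≠ c) :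
    ∃ d, ¬M.toCoxeterSystem.IsLeftDescent (δ d z) i ∧
      ¬M.toCoxeterSystem.IsLeftDescent (δ d z) j ∧
      (D.adj j).r d b ∧ d ≠ b ∧ (D.adj i).r d b' ∧ d ≠ b' := by
  set cs := M.toCoxeterSystem
  have hji : M j i = 2 := (M.symmetric j i).trans hij
  have hdesc : cs.IsLeftDescent (δ b z) j := by
    rw [← isLeftDescent_simple_mul_iff_of_eq_two cs hM hij,
      ← hδ.eq_simple_mul_of_adj hbi ((D.adj i).symm' hbc) hne.symm]
    exact hδ.isLeftDescent_of_adj hbj ((D.adj j).symm' hbc') hne'.symm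
  have hdesc' : cs.IsLeftDescent (δ b' z) i := by
    rw [← isLeftDescent_simple_mul_iff_of_eq_two cs hM hji,
      ← hδ.eq_simple_mul_of_adj hbj ((D.adj j).symm' hbc') hne'.symm]
    exact hδ.isLeftDescent_of_adj hbi ((D.adj i).symm' hbc) hne.symm
  obtain ⟨d, hbd, hne_bd, hd⟩ := hδ.exists_adj_of_isLeftDescent hdesc
  have hdi : ¬cs.IsLeftDescent (δ d z) i := by
    rwa [hd, isLeftDescent_simple_mul_iff_of_eq_two cs hM hji]
  have hdj : ¬cs.IsLeftDescent (δ d z) j := by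
    rwa [hd, ← cs.isLeftDescent_iff_not_isLeftDescent_mul]
  obtain ⟨u, hdu, huc⟩ :=
    hδ.exists_adj_adj_of_eq_two hM hji ((D.adj j).symm' hbd) hne_bd.symm hbc hne
  have huj : ¬cs.IsLeftDescent (δ u z) j := by
    rcases eq_or_ne u d with rfl | hud
    · exact hdj
    · rwa [hδ.eq_simple_mul_of_adj hdi ((D.adj i).symm' hdu) hud,
        isLeftDescent_simple_mul_iff_of_eq_two cs hM hij]
  obtain rfl := hδ.eq_of_adj huj hbj ((D.adj j).trans' huc ((D.adj j).symm' hbc'))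
  exact ⟨d, hdi, hdj, (D.adj j).symm' hbd, hne_bd.symm, hdu, fun h => hdi (h ▸ hdesc')⟩

end IsWeylDistance

namespace LegalColouring

variable {X : I → Type*} (L : D.LegalColouring X)

/-- The chamber of `i`-colour `x` in the `i`-panel of `c`. -/
noncomputable def move (c : C) (i : I) (x : X i) : C :=
  ((L.panelColour i c).symm x).1

theorem adj_move (c : C) (i : I) (x : X i) : (D.adj i).r c (L.move c i x) :=
  ((L.panelColour i c).symm x).2

theorem col_move_self (c : C) (i : I) (x : X i) : L.col (L.move c i x) i = x :=
  (L.panelColour i c).apply_symm_apply x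

theorem col_move_of_ne (c : C) (i : I) (x : X i) {j : I} (h : j ≠ i) :
    L.col (L.move c i x) j = L.col c j :=
  L.constant i j h c _ (L.adj_move c i x)

theorem move_col_of_adj {c d : C} {i : I} (h : (D.adj i).r c d) :
    L.move c i (L.col d i) = d :=
  congrArg Subtype.val ((L.panelColour i c).symm_apply_apply ⟨d, h⟩)

theorem move_col (c : C) (i : I) : L.move c i (L.col c i) = c :=
  L.move_col_of_adj ((D.adj i).refl' c)

theorem move_of_adj {c d : C} {i : I} (h : (D.adj i).r c d) (x : X i) :
    L.move d i x = L.move c i x := by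
  rw [← L.move_col_of_adj ((D.adj i).trans' h (L.adj_move d i x)), col_move_self]

theorem move_move (c : C) (i : I) (x y : X i) : L.move (L.move c i x) i y = L.move c i y :=
  L.move_of_adj (L.adj_move c i x) y

theorem ne_move_iff {c : C} {i : I} {x : X i} : c ≠ L.move c i x ↔ x ≠ L.col c i := by
  refine not_congr ⟨fun h => ?_, fun h => ?_⟩
  · rw [h, col_move_self]
  · rw [h, move_col]

theorem move_comm (hM : M.IsRightAngled) (hD : D.IsBuilding M) {i j : I} (hij : M i j = 2)
    (c : C) (x : X i) (y : X j) :
    L.move (L.move c i x) j y = L.move (L.move c j y) i x := by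
  have hne : i ≠ j := by
    rintro rfl
    simp at hij
  by_cases hx : x = L.col c i
  · rw [hx, move_col, ← L.col_move_of_ne c j y hne, move_col]
  by_cases hy : y = L.col c j
  · rw [hy, move_col, ← L.col_move_of_ne c i x hne.symm, move_col]
  obtain ⟨δ, hδ : D.IsWeylDistance M δ⟩ := hD.exists_dist
  obtain ⟨u, hcu, hue⟩ := hδ.exists_adj_adj_of_eq_two hM hij (L.adj_move c i x)
    (L.ne_move_iff.2 hx) (L.adj_move (L.move c i x) j y)
    (L.ne_move_iff.2 (by rwa [L.col_move_of_ne _ _ _ hne.symm]))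
  have huy : L.col u j = y := by
    rw [← L.constant i j hne.symm u _ hue, col_move_self]
  have hcolx : L.col (L.move (L.move c i x) j y) i = x := by
    rw [L.col_move_of_ne _ _ _ hne, col_move_self]
  rw [← L.move_col_of_adj hue, hcolx, ← L.move_col_of_adj hcu, huy]

theorem move_induction (hD : D.IsBuilding M) {p : C → Prop} (c₀ : C) (base : p c₀)
    (move : ∀ c i x, p c → p (L.move c i x)) (c : C) : p c := by
  obtain ⟨δ, hδ : D.IsWeylDistance M δ⟩ := hD.exists_dist
  obtain ⟨w, hw⟩ := hδ.exists_gallery c c₀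
  induction w generalizing c with
  | nil => rwa [show c = c₀ from hw]
  | cons i w ih =>
    obtain ⟨d, hcd, -, hd⟩ := hw
    rw [← L.move_col_of_adj ((D.adj i).symm' hcd)]
    exact move d i _ (ih d hd)

/-- The system of moves on the chambers of a right-angled building. -/
noncomputable def moveSystem (hM : M.IsRightAngled) (hD : D.IsBuilding M) :
    MoveSystem M X C where
  col := L.col
  act := L.move
  col_act_self := L.col_move_self
  col_act_of_ne c i x _ h := L.col_move_of_ne c i x h
  act_col := L.move_col
  act_act := L.move_move
  act_comm _ _ h := L.move_comm hM hD h

section Universality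

variable {S : Type*} (δ : C → C → M.Group) (A : MoveSystem M X S) (c₀ : C) (s₀ : S)

/-- `L.Development δ A c₀ s₀ c s`: along some minimal gallery from `c₀` to `c`, the moves of `A`
prescribed by the colours of the chambers lead from `s₀` to `s`. -/
inductive Development : C → S → Prop
  | base : Development c₀ s₀
  | step {b c : C} {s : S} {i : I} (h : Development b s)
      (hi : ¬M.toCoxeterSystem.IsLeftDescent (δ b c₀) i) (hbc : (D.adj i).r b c) (hne : b ≠ c) :
      Development c (A.act s i (L.col c i))

variable {L δ A c₀ s₀}

theorem Development.col_eq (h₀ : A.col s₀ = L.col c₀) {c : C} {s : S}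
    (h : L.Development δ A c₀ s₀ c s) : A.col s = L.col c := by
  induction h with
  | base => exact h₀
  | @step b c s i _ _ hbc _ ih =>
    ext j
    rcases eq_or_ne j i with rfl | hj
    · rw [A.col_act_self]
    · rw [A.col_act_of_ne _ _ _ _ hj, ih, L.constant i j hj b c hbc]

theorem exists_development (hδ : D.IsWeylDistance M δ) (c : C) :
    ∃ s, L.Development δ A c₀ s₀ c s := by
  induction hw : δ c c₀ using ascending_induction M.toCoxeterSystem generalizing c with
  | one =>
    obtain rfl := hδ.eq_one_iff.1 hw
    exact ⟨s₀, .base⟩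
  | simple_mul w i hi ih =>
    obtain ⟨b, hcb, hne, hb⟩ := hδ.exists_adj_of_isLeftDescent (i := i) (x := c) (z := c₀) <| by
      rw [hw]
      exact isLeftDescent_simple_mul _ hi
    rw [hw, CoxeterSystem.simple_mul_simple_cancel_left] at hb
    obtain ⟨s, hs⟩ := ih b hb
    exact ⟨_, hs.step (hb ▸ hi) ((D.adj i).symm' hcb) hne.symm⟩

/-- Two minimal galleries from `c₀` to `c` that end with moves of different types `i` and `j` can be
replaced by galleries that end with a commuting square of moves, since the descents `i` and `j`
commute. -/
theorem Development.unique (hδ : D.IsWeylDistance M δ) (hM : M.IsRightAngled) {c : C} {s s' : S}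
    (h : L.Development δ A c₀ s₀ c s) (h' : L.Development δ A c₀ s₀ c s') : s = s' := by
  induction hn : M.toCoxeterSystem.length (δ c c₀) using Nat.strong_induction_on
    generalizing c s s' with
  | h n ih =>
  subst hn
  have hlt {b : C} {i : I} (hi : ¬M.toCoxeterSystem.IsLeftDescent (δ b c₀) i)
      (hbc : (D.adj i).r b c) (hne : b ≠ c) :=
    hδ.length_lt_of_adj hi ((D.adj i).symm' hbc) hne.symm
  have hlen : c = c₀ → M.toCoxeterSystem.length (δ c c₀) = 0 := fun h => by
    rw [hδ.eq_one_iff.2 h, CoxeterSystem.length_one]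
  cases h with
  | base =>
    cases h' with
    | base => rfl
    | step _ hi hbc hne => exact absurd (hlt hi hbc hne) (by simp [hlen rfl])
  | @step b _ t i ht hi hbc hne =>
    cases h' with
    | base => exact absurd (hlt hi hbc hne) (by simp [hlen rfl])
    | @step b' _ t' j ht' hj hbc' hne' =>
      rcases eq_or_ne i j with rfl | hij
      · obtain rfl := hδ.eq_of_adj hi hj ((D.adj i).trans' hbc ((D.adj i).symm' hbc'))
        rw [ih _ (hlt hi hbc hne) ht ht' rfl]
      have hij2 : M i j = 2 := eq_two_of_isLeftDescent _ hM hij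
        (hδ.isLeftDescent_of_adj hi ((D.adj i).symm' hbc) hne.symm)
        (hδ.isLeftDescent_of_adj hj ((D.adj j).symm' hbc') hne'.symm)
      obtain ⟨d, hdi, hdj, hdb, hne_db, hdb', hne_db'⟩ :=
        hδ.exists_square_of_isLeftDescent hM hij2 hi hbc hne hj hbc' hne'
      obtain ⟨r, hr⟩ := exists_development (L := L) (A := A) (s₀ := s₀) hδ d
      rw [ih _ (hlt hi hbc hne) ht (hr.step hdj hdb hne_db) rfl,
        ih _ (hlt hj hbc' hne') ht' (hr.step hdi hdb' hne_db') rfl,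
        ← L.constant i j hij.symm b c hbc, ← L.constant j i hij b' c hbc', A.act_comm i j hij2]

variable (L)

/-- Writing `d` for the chamber of the `i`-panel of `c` nearest to `c₀`, both `c` and `L.move c i x`
are developed through `d`. -/
theorem exists_moveHom (hM : M.IsRightAngled) (hD : D.IsBuilding M) (A : MoveSystem M X S)
    (c₀ : C) (s₀ : S) (h₀ : A.col s₀ = L.col c₀) :
    ∃ H : C → S, H c₀ = s₀ ∧ (∀ c i x, H (L.move c i x) = A.act (H c) i x) ∧
      ∀ c, A.col (H c) = L.col c := by
  obtain ⟨δ, hδ : D.IsWeylDistance M δ⟩ := hD.exists_dist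
  choose H hH using exists_development (L := L) (A := A) (c₀ := c₀) (s₀ := s₀) hδ
  have hcol : ∀ c, A.col (H c) = L.col c := fun c => (hH c).col_eq h₀
  have heq {c : C} {s : S} (hs : L.Development δ A c₀ s₀ c s) : H c = s := (hH c).unique hδ hM hs
  refine ⟨H, heq .base, fun c i x => ?_, hcol⟩
  obtain ⟨d, hcd, hd⟩ := hδ.exists_adj_not_isLeftDescent i c c₀
  have hdev (y : X i) : H (L.move d i y) = A.act (H d) i y := by
    by_cases hy : y = L.col d i
    · rw [hy, move_col, ← hcol, A.act_col]
    · have hstep := (hH d).step hd (L.adj_move d i y) (L.ne_move_iff.2 hy)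
      rw [col_move_self] at hstep
      exact heq hstep
  have hc : H c = A.act (H d) i (L.col c i) := by
    rw [← hdev, L.move_col_of_adj ((D.adj i).symm' hcd)]
  rw [hc, A.act_act, ← hdev, L.move_of_adj hcd]

end Universality

theorem exists_moveHom_twist (hM : M.IsRightAngled) (hD : D.IsBuilding M)
    (f : ∀ i, Equiv.Perm (X i)) {c₀ d₀ : C} (h : ∀ i, f i (L.col c₀ i) = L.col d₀ i) :
    ∃ H : C → C, H c₀ = d₀ ∧ (∀ c i x, H (L.move c i x) = L.move (H c) i (f i x)) ∧
      ∀ c i, L.col (H c) i = f i (L.col c i) := by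
  obtain ⟨H, hH₀, hH, hcol⟩ := L.exists_moveHom hM hD ((L.moveSystem hM hD).twist f) c₀ d₀
    (funext fun i => (f i).symm_apply_eq.2 (h i).symm)
  exact ⟨H, hH₀, hH, fun c i => (f i).symm_apply_eq.1 (congrFun (hcol c) i)⟩

theorem exists_aut (hM : M.IsRightAngled) (hD : D.IsBuilding M) (f : ∀ i, Equiv.Perm (X i))
    {c₀ d₀ : C} (h : ∀ i, f i (L.col c₀ i) = L.col d₀ i) :
    ∃ g : D.Aut, g.1 c₀ = d₀ ∧ ∀ i c, L.localAction g i c = f i := by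
  obtain ⟨H, hH₀, hH, hcol⟩ := L.exists_moveHom_twist hM hD f h
  obtain ⟨K, hK₀, hK, -⟩ := L.exists_moveHom_twist hM hD (fun i => (f i).symm)
    fun i => (f i).symm_apply_eq.2 (h i).symm
  have hKH : Function.LeftInverse K H :=
    L.move_induction hD c₀ (by rw [hH₀, hK₀]) fun c i x ih => by
      rw [hH, hK, ih, Equiv.symm_apply_apply]
  have hHK : Function.RightInverse K H :=
    L.move_induction hD d₀ (by rw [hK₀, hH₀]) fun c i x ih => by
      rw [hK, hH, ih, Equiv.apply_symm_apply]
  have adj_H {i : I} {x y : C} (hxy : (D.adj i).r x y) : (D.adj i).r (H x) (H y) := by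
    rw [← L.move_col_of_adj hxy, hH]
    exact L.adj_move _ _ _
  have adj_K {i : I} {x y : C} (hxy : (D.adj i).r x y) : (D.adj i).r (K x) (K y) := by
    rw [← L.move_col_of_adj hxy, hK]
    exact L.adj_move _ _ _
  refine ⟨⟨⟨H, K, hKH, hHK⟩, fun i x y => ⟨fun hxy => ?_, adj_H⟩⟩, hH₀, fun i c => ?_⟩
  · rw [← hKH x, ← hKH y]
    exact adj_K hxy
  · ext x
    obtain ⟨d, hd, rfl⟩ := L.exists_col_eq i c x
    rw [L.localAction_col _ i c d hd]
    exact hcol d i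

theorem exists_potential (hM : M.IsRightAngled) (hD : D.IsBuilding M) {G : Type*} [Group G]
    (φ : ∀ i, X i → G) (hφ : ∀ i j, M i j = 2 → ∀ x y, Commute (φ i x) (φ j y)) :
    ∃ H : C → G, ∀ c i x, H (L.move c i x) = H c * ((φ i (L.col c i))⁻¹ * φ i x) := by
  obtain ⟨c₀⟩ := hD.nonempty
  obtain ⟨H, -, hH, hcol⟩ :=
    L.exists_moveHom hM hD (MoveSystem.ofGroup φ hφ) c₀ (1, L.col c₀) rfl
  refine ⟨fun c => (H c).1, fun c i x => ?_⟩
  simp only [hH, ← hcol c]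
  rfl

end LegalColouring

end ChamberSystem

section PlusSubgroup

variable {G : Type*} [Group G] {Y : Type*} [MulAction G Y] {H : Subgroup G}

theorem plusSubgroup_le (Y : Type*) [MulAction G Y] (H : Subgroup G) : plusSubgroup Y H ≤ H :=
  iSup_le fun _ => inf_le_left

theorem mem_plusSubgroup {g : G} (hg : g ∈ H) {y : Y} (hy : g • y = y) : g ∈ plusSubgroup Y H :=
  Subgroup.mem_iSup_of_mem (S := fun y : Y => H ⊓ MulAction.stabilizer G y) y ⟨hg, hy⟩

theorem plusSubgroup_induction {p : G → Prop} (fix : ∀ g ∈ H, ∀ y : Y, g • y = y → p g)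
    (one : p 1) (mul : ∀ g h, p g → p h → p (g * h)) {g : G} (hg : g ∈ plusSubgroup Y H) : p g :=
  Subgroup.iSup_induction _ (C := p) hg (fun y g hg => fix g hg.1 y hg.2) one mul

end PlusSubgroup

namespace ChamberSystem.LegalColouring

open RightAngledCoxeter

variable {I C : Type*} {D : ChamberSystem I C} {M : CoxeterMatrix I} {X : I → Type*}
  (L : D.LegalColouring X)

theorem localAction_apply_col (g : D.Aut) (i : I) (c : C) :
    L.localAction g i c (L.col c i) = L.col (g.1 c) i :=
  L.localAction_col g i c c ((D.adj i).refl' c)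

theorem localAction_move (g : D.Aut) (c : C) (i : I) (x : X i) :
    L.localAction g i (L.move c i x) = L.localAction g i c := by
  ext y
  obtain ⟨e, he, rfl⟩ := L.exists_col_eq i (L.move c i x) y
  rw [L.localAction_col g i _ e he,
    L.localAction_col g i c e ((D.adj i).trans' (L.adj_move c i x) he)]

theorem apply_move (g : D.Aut) (c : C) (i : I) (x : X i) :
    g.1 (L.move c i x) = L.move (g.1 c) i (L.localAction g i c x) := by
  rw [← L.move_col_of_adj ((g.2 i _ _).2 (L.adj_move c i x)),
    ← L.localAction_col g i c _ (L.adj_move c i x), col_move_self]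

variable (F : ∀ i, Subgroup (Equiv.Perm (X i)))

variable {F} in
theorem exists_mem_universalGroup_localAction_eq (hM : M.IsRightAngled) (hD : D.IsBuilding M)
    {i : I} {f : Equiv.Perm (X i)} (hf : f ∈ F i) (c : C) :
    ∃ g ∈ L.universalGroup F, g.1 c = L.move c i (f (L.col c i)) ∧
      ∀ d, L.localAction g i d = f := by
  classical
  have hcol (j : I) : (Pi.mulSingle i f : ∀ j, Equiv.Perm (X j)) j (L.col c j) =
      L.col (L.move c i (f (L.col c i))) j := by
    rcases eq_or_ne j i with rfl | hj
    · rw [Pi.mulSingle_eq_same, col_move_self]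
    · rw [Pi.mulSingle_eq_of_ne hj, L.col_move_of_ne _ _ _ hj, Equiv.Perm.one_apply]
  obtain ⟨g, hgc, hg⟩ := L.exists_aut hM hD _ hcol
  refine ⟨g, fun j d => ?_, hgc, fun d => by rw [hg, Pi.mulSingle_eq_same]⟩
  rw [hg]
  exact (Subgroup.mulSingle_mem_pi (I := Set.univ) (H := F) i f).2 (fun _ => hf) j (Set.mem_univ j)

section Obstruction

theorem plusSubgroup_universalGroup_le (hD : D.IsBuilding M) :
    plusSubgroup C (L.universalGroup F) ≤
      L.universalGroup fun i => plusSubgroup (X i) (F i) := by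
  refine iSup_le fun c₀ g ⟨hg, hc₀⟩ i => ?_
  replace hc₀ : g.1 c₀ = c₀ := hc₀
  refine L.move_induction hD c₀ (mem_plusSubgroup (hg i c₀) (y := L.col c₀ i) ?_)
    fun c j x ih => ?_
  · rw [Equiv.Perm.smul_def, localAction_apply_col, hc₀]
  rcases eq_or_ne i j with rfl | hij
  · rwa [localAction_move]
  have hfix : (L.localAction g i c)⁻¹ * L.localAction g i (L.move c j x) ∈
      plusSubgroup (X i) (F i) := by
    refine mem_plusSubgroup ((F i).mul_mem ((F i).inv_mem (hg i c)) (hg i _))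
      (y := L.col c i) ?_
    rw [Equiv.Perm.smul_def, Equiv.Perm.mul_apply, Equiv.Perm.inv_eq_iff_eq,
      localAction_apply_col, ← L.col_move_of_ne c j x hij, localAction_apply_col, apply_move,
      col_move_of_ne _ _ _ _ hij]
  simpa only [mul_inv_cancel_left] using (plusSubgroup (X i) (F i)).mul_mem ih hfix

variable {F}

theorem plusSubgroup_eq_of_plusSubgroup_universalGroup_eq (hM : M.IsRightAngled)
    (hD : D.IsBuilding M) (hU : plusSubgroup C (L.universalGroup F) = L.universalGroup F) (i : I) :
    plusSubgroup (X i) (F i) = F i := by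
  refine le_antisymm (plusSubgroup_le _ _) fun f hf => ?_
  obtain ⟨c⟩ := hD.nonempty
  obtain ⟨g, hgU, -, hg⟩ := L.exists_mem_universalGroup_localAction_eq hM hD hf c
  rw [← hg c]
  exact L.plusSubgroup_universalGroup_le F hD (hU.symm ▸ hgU) i c

theorem potential_apply_of_mem_plusSubgroup (hD : D.IsBuilding M) {G : Type*} [Group G]
    {φ : ∀ i, X i → G} (hφ : ∀ i, ∀ f ∈ F i, ∀ x, φ i (f x) = φ i x) {H : C → G}
    (hH : ∀ c i x, H (L.move c i x) = H c * ((φ i (L.col c i))⁻¹ * φ i x)) {g : D.Aut}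
    (hg : g ∈ plusSubgroup C (L.universalGroup F)) (c : C) : H (g.1 c) = H c := by
  refine plusSubgroup_induction (p := fun g => ∀ c, H (g.1 c) = H c)
    (fun g hg c₀ hc₀ => ?_) (fun _ => rfl) (fun g h hg hh c => (hg (h.1 c)).trans (hh c)) hg c
  replace hc₀ : g.1 c₀ = c₀ := hc₀
  refine L.move_induction hD c₀ (by rw [hc₀]) fun c i x ih => ?_
  rw [apply_move, hH, hH, ih, hφ i _ (hg i c), ← localAction_apply_col, hφ i _ (hg i c)]

theorem exists_mem_universalGroup_apply_eq_move_commutator (hM : M.IsRightAngled)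
    (hD : D.IsBuilding M) {i j : I} (hij : i ≠ j) (c : C) (x : X i) (y : X j) :
    ∃ g ∈ L.universalGroup F, g.1 c =
      L.move (L.move (L.move (L.move c i x) j y) i (L.col c i)) j (L.col c j) := by
  set d := L.move (L.move (L.move (L.move c i x) j y) i (L.col c i)) j (L.col c j) with hd
  have hcol (k : I) : (1 : Equiv.Perm (X k)) (L.col c k) = L.col d k := by
    rw [Equiv.Perm.one_apply]
    rcases eq_or_ne k j with rfl | hkj
    · rw [hd, col_move_self]
    rcases eq_or_ne k i with rfl | hki
    · rw [hd, col_move_of_ne _ _ _ _ hkj, col_move_self]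
    · simp only [hd, col_move_of_ne _ _ _ _ hkj, col_move_of_ne _ _ _ _ hki]
  obtain ⟨g, hgc, hg⟩ := L.exists_aut hM hD _ hcol
  refine ⟨g, fun k e => ?_, hgc⟩
  rw [hg]
  exact (F k).one_mem

section OrbitWeight

variable (M F)

open Classical in
/-- The weight of the colour `x : X i` in the potential that records, by a factor equal to the
simple reflection `i`, when an `i`-colour enters or leaves the `F i`-orbit of the `i`-colour of
`c`. -/
noncomputable def orbitWeight (c : C) (i : I) (x : X i) : M.Group :=
  if x ∈ MulAction.orbit (F i) (L.col c i) then 1 else M.toCoxeterSystem.simple i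

variable {M F}

theorem orbitWeight_col (c : C) (i : I) : L.orbitWeight M F c i (L.col c i) = 1 :=
  if_pos (MulAction.mem_orbit_self _)

theorem orbitWeight_of_notMem {c : C} {i : I} {x : X i}
    (hx : x ∉ MulAction.orbit (F i) (L.col c i)) :
    L.orbitWeight M F c i x = M.toCoxeterSystem.simple i :=
  if_neg hx

open Classical in
theorem orbitWeight_apply (c : C) (i : I) (f : Equiv.Perm (X i)) (hf : f ∈ F i) (x : X i) :
    L.orbitWeight M F c i (f x) = L.orbitWeight M F c i x := by
  have horbit : f x ∈ MulAction.orbit (F i) (L.col c i) ↔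
      x ∈ MulAction.orbit (F i) (L.col c i) := by
    rw [← MulAction.orbit_eq_iff, ← MulAction.orbit_eq_iff]
    exact Eq.congr_left (MulAction.orbit_smul (⟨f, hf⟩ : F i) x)
  exact if_congr horbit rfl rfl

theorem commute_orbitWeight (c : C) (i j : I) (hij : M i j = 2) (x : X i) (y : X j) :
    Commute (L.orbitWeight M F c i x) (L.orbitWeight M F c j y) := by
  rw [orbitWeight, orbitWeight]
  split_ifs
  exacts [.one_left _, .one_left _, .one_right _, commute_simple M.toCoxeterSystem hij]

end OrbitWeight

theorem isPretransitive_or_of_plusSubgroup_universalGroup_eq (hM : M.IsRightAngled)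
    (hD : D.IsBuilding M) (hU : plusSubgroup C (L.universalGroup F) = L.universalGroup F)
    {i j : I} (hij : M i j = 0) :
    MulAction.IsPretransitive (F i) (X i) ∨ MulAction.IsPretransitive (F j) (X j) := by
  have hne : i ≠ j := by
    rintro rfl
    simp at hij
  obtain ⟨c⟩ := hD.nonempty
  by_contra! hcon
  simp only [MulAction.isPretransitive_iff_base (L.col c _), not_forall] at hcon
  obtain ⟨⟨x, hx⟩, ⟨y, hy⟩⟩ := hcon
  obtain ⟨H, hH⟩ := L.exists_potential hM hD (L.orbitWeight M F c) (L.commute_orbitWeight c)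
  obtain ⟨g, hg, hgc⟩ :=
    L.exists_mem_universalGroup_apply_eq_move_commutator (F := F) hM hD hne c x y
  have hinv := L.potential_apply_of_mem_plusSubgroup hD (L.orbitWeight_apply c) hH (hU.symm ▸ hg) c
  simp only [hgc, hH, col_move_self, col_move_of_ne _ _ _ _ hne, col_move_of_ne _ _ _ _ hne.symm,
    orbitWeight_col, L.orbitWeight_of_notMem hx, L.orbitWeight_of_notMem hy, mul_one, inv_one,
    one_mul, mul_assoc, mul_eq_left] at hinv
  have hcomm : Commute (M.toCoxeterSystem.simple i) (M.toCoxeterSystem.simple j) :=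
    commutatorElement_eq_one_iff_commute.1 (by simpa only [commutatorElement_def, mul_assoc])
  rw [eq_two_of_commute_simple _ hM hne hcomm] at hij
  exact two_ne_zero hij

end Obstruction

/-- The chamber reached from `c` by moves to the colours `z i`, for the letters `i` of `w` from
right to left. -/
noncomputable def moves (c : C) (w : List I) (z : ∀ i, X i) : C :=
  w.foldr (fun i d => L.move d i (z i)) c

theorem moves_col (c : C) (w : List I) : L.moves c w (L.col c) = c := by
  induction w with
  | nil => rfl
  | cons i w ih => rw [moves, List.foldr_cons, ← moves, ih, move_col]

section Generation

/-- Two chambers are related when they lie in the same orbit of `U⁺`. -/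
def PlusRel (c d : C) : Prop := ∃ g ∈ plusSubgroup C (L.universalGroup F), g.1 c = d

variable {L F}

theorem PlusRel.refl (c : C) : L.PlusRel F c c := ⟨1, Subgroup.one_mem _, rfl⟩

theorem PlusRel.symm {c d : C} : L.PlusRel F c d → L.PlusRel F d c := by
  rintro ⟨g, hg, rfl⟩
  exact ⟨g⁻¹, Subgroup.inv_mem _ hg, g.1.symm_apply_apply c⟩

theorem PlusRel.trans {c d e : C} : L.PlusRel F c d → L.PlusRel F d e → L.PlusRel F c e := by
  rintro ⟨g, hg, rfl⟩ ⟨h, hh, rfl⟩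
  exact ⟨h * g, Subgroup.mul_mem _ hh hg, rfl⟩

theorem plusRel_move_of_mem_plusSubgroup (hM : M.IsRightAngled) (hD : D.IsBuilding M) {i : I}
    {f : Equiv.Perm (X i)} (hf : f ∈ plusSubgroup (X i) (F i)) (c : C) :
    L.PlusRel F c (L.move c i (f (L.col c i))) := by
  refine plusSubgroup_induction (p := fun f => ∀ c, L.PlusRel F c (L.move c i (f (L.col c i))))
    (fun f hf x hx c => ?_) (fun c => ?_) (fun f g hf hg c => ?_) hf c
  · replace hx : f x = x := hx
    obtain ⟨g, hgU, hgfix, hg⟩ := L.exists_mem_universalGroup_localAction_eq hM hD hf (L.move c i x)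
    rw [col_move_self, hx, move_move] at hgfix
    have hgc := L.apply_move g (L.move c i x) i (L.col c i)
    rw [hgfix, hg, move_move, move_move, move_col] at hgc
    exact ⟨g, mem_plusSubgroup hgU hgfix, hgc⟩
  · rw [Equiv.Perm.one_apply, move_col]
    exact PlusRel.refl c
  · have hfg := (hg c).trans (hf _)
    rwa [col_move_self, move_move] at hfg

variable (hM : M.IsRightAngled) (hD : D.IsBuilding M) (hF : ∀ i, plusSubgroup (X i) (F i) = F i)
include hM hD hF

theorem PlusRel.move {c d : C} (h : L.PlusRel F c d) {i : I} {f : Equiv.Perm (X i)}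
    (hf : f ∈ F i) (x : X i) : L.PlusRel F (L.move c i x) (L.move d i (f x)) := by
  obtain ⟨g, hg, rfl⟩ := h
  have hσ := plusSubgroup_le _ _ hg i c
  have hστ := plusRel_move_of_mem_plusSubgroup (L := L) hM hD
    ((hF i).symm ▸ (F i).mul_mem ((F i).inv_mem hσ) hf) (L.move c i x)
  rw [col_move_self, move_move] at hστ
  refine hστ.trans ⟨g, hg, ?_⟩
  rw [apply_move, ← Equiv.Perm.mul_apply, mul_inv_cancel_left]

theorem PlusRel.move_right {c d : C} (h : L.PlusRel F c d) (i : I) (x : X i) :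
    L.PlusRel F (L.move c i x) (L.move d i x) :=
  h.move hM hD hF (F i).one_mem x

theorem plusRel_move_of_isPretransitive {i : I} (ht : MulAction.IsPretransitive (F i) (X i))
    (c : C) (x : X i) : L.PlusRel F c (L.move c i x) := by
  obtain ⟨⟨f, hf⟩, rfl⟩ := MulAction.exists_smul_eq (F i) (L.col c i) x
  exact plusRel_move_of_mem_plusSubgroup hM hD ((hF i).symm ▸ hf) c

theorem plusRel_move_move_of_isPretransitive {i j : I}
    (ht : MulAction.IsPretransitive (F j) (X j)) (c : C) (x : X i) (y : X j) :
    L.PlusRel F (L.move (L.move c i x) j y) (L.move (L.move c j y) i x) :=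
  (plusRel_move_of_isPretransitive hM hD hF ht (L.move c i x) y).symm.trans
    ((plusRel_move_of_isPretransitive hM hD hF ht c y).move_right hM hD hF i x)

theorem plusRel_moves_of_mem {w : List I} {z z' : ∀ i, X i} (hz : ∀ i, ∃ f ∈ F i, f (z i) = z' i)
    (c : C) : L.PlusRel F (L.moves c w z) (L.moves c w z') := by
  induction w with
  | nil => exact PlusRel.refl c
  | cons i w ih =>
    obtain ⟨f, hf, hfz⟩ := hz i
    have h := ih.move hM hD hF hf (z i)
    rwa [hfz] at h

variable {V : Set I} (hV : M.diagram.IsVertexCover V)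
  (ht : ∀ i ∈ V, MulAction.IsPretransitive (F i) (X i))
include hV ht

theorem plusRel_move_move {i j : I} (hij : i ≠ j) (c : C) (x : X i) (y : X j) :
    L.PlusRel F (L.move (L.move c i x) j y) (L.move (L.move c j y) i x) := by
  rcases hM i j hij with h | h
  · rw [L.move_comm hM hD h]
    exact PlusRel.refl _
  rcases hV (show M.diagram.Adj i j from h) with hi | hj
  · exact (plusRel_move_move_of_isPretransitive hM hD hF (ht i hi) c y x).symm
  · exact plusRel_move_move_of_isPretransitive hM hD hF (ht j hj) c x y

/-- Modulo `U⁺` the last `i`-move overrides the earlier ones, as moves commute. -/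
theorem plusRel_move_moves {w : List I} {i : I} {z z' : ∀ i, X i} (hz : ∀ j ≠ i, z j = z' j)
    (c : C) (x : X i) :
    L.PlusRel F (L.move (L.moves c w z) i x) (L.move (L.moves c w z') i x) := by
  induction w with
  | nil => exact PlusRel.refl _
  | cons j w ih =>
    have hcons (z : ∀ i, X i) : L.moves c (j :: w) z = L.move (L.moves c w z) j (z j) := rfl
    rw [hcons, hcons]
    rcases eq_or_ne j i with rfl | hj
    · rwa [move_move, move_move]
    · rw [← hz j hj]
      exact (plusRel_move_move hM hD hF hV ht hj _ _ _).trans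
        ((ih.move_right hM hD hF j (z j)).trans (plusRel_move_move hM hD hF hV ht hj.symm _ _ _))

theorem plusRel_moves_of_gallery {w : List I} {c d : C} (h : D.Gallery w c d) :
    L.PlusRel F c (L.moves d w (L.col c)) := by
  induction w generalizing c with
  | nil =>
    obtain rfl : c = d := h
    exact PlusRel.refl c
  | cons i w ih =>
    obtain ⟨e, hce, -, he⟩ := h
    have hc := (ih he).move_right hM hD hF i (L.col c i)
    rw [L.move_col_of_adj ((D.adj i).symm' hce)] at hc
    exact hc.trans (plusRel_move_moves hM hD hF hV ht (fun j hj => L.constant i j hj c e hce) d _)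

theorem plusSubgroup_universalGroup_eq :
    plusSubgroup C (L.universalGroup F) = L.universalGroup F := by
  refine le_antisymm (plusSubgroup_le _ _) fun g hg => ?_
  obtain ⟨c⟩ := hD.nonempty
  obtain ⟨δ, hδ : D.IsWeylDistance M δ⟩ := hD.exists_dist
  obtain ⟨w, hw⟩ := hδ.exists_gallery (g.1 c) c
  have hcol := plusRel_moves_of_mem (L := L) (F := F) (w := w) (z := L.col c)
    (z' := L.col (g.1 c)) hM hD hF (fun i => ⟨_, hg i c, L.localAction_apply_col g i c⟩) c
  rw [moves_col] at hcol
  obtain ⟨h, hh, hhgc⟩ := (plusRel_moves_of_gallery hM hD hF hV ht hw).trans hcol.symm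
  have hhg : h * g ∈ plusSubgroup C (L.universalGroup F) :=
    mem_plusSubgroup (mul_mem (plusSubgroup_le _ _ hh) hg) (y := c) hhgc
  exact (Subgroup.mul_mem_cancel_left _ hh).1 hhg

end Generation

end ChamberSystem.LegalColouring

theorem mainTheorem2_general {I C : Type*} (M : CoxeterMatrix I) (hM : M.IsRightAngled)
    (D : ChamberSystem I C) (hD : D.IsBuilding M) {X : I → Type*} (L : D.LegalColouring X)
    (F : ∀ i, Subgroup (Equiv.Perm (X i))) :
    plusSubgroup C (L.universalGroup F) = L.universalGroup F ↔
      (∀ i, plusSubgroup (X i) (F i) = F i) ∧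
        ∃ V : Set I, M.diagram.IsVertexCover V ∧
          ∀ i ∈ V, MulAction.IsPretransitive (F i) (X i) := by
  constructor
  · intro hU
    exact ⟨L.plusSubgroup_eq_of_plusSubgroup_universalGroup_eq hM hD hU,
      {i | MulAction.IsPretransitive (F i) (X i)},
      fun i j hij => L.isPretransitive_or_of_plusSubgroup_universalGroup_eq hM hD hU hij,
      fun i hi => hi⟩
  · rintro ⟨hF, V, hV, ht⟩
    exact ChamberSystem.LegalColouring.plusSubgroup_universalGroup_eq hM hD hF hV ht

theorem mainTheorem2 {I C : Type*} [Finite I] (M : CoxeterMatrix I) (hM : M.IsRightAngled)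
    (D : ChamberSystem I C) (hD : D.IsBuilding M) {X : I → Type*} (L : D.LegalColouring X)
    (F : ∀ i, Subgroup (Equiv.Perm (X i))) :
    plusSubgroup C (L.universalGroup F) = L.universalGroup F ↔
      (∀ i, plusSubgroup (X i) (F i) = F i) ∧
        ∃ V : Set I, M.diagram.IsVertexCover V ∧
          ∀ i ∈ V, MulAction.IsPretransitive (F i) (X i) :=
  mainTheorem2_general M hM D hD L F
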